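/- Let $\mathcal X,\mathcal Y$ be finite sets, $\mathcal X\neq\emptyset$, and let $W=(W_x)_{x\in\mathcal X}$ be a channel: each $W_x$ is a probability distribution on $\mathcal Y$. Assume that the distributions $W_x$ are linearly independent. Let $H$ be the Shannon entropy and $D$ the Kullback–Leibler divergence (natural logarithms). For nonempty $S\subseteq\mathcal X$ let $C(S)=\max_q D(W\times q\,\|\,(W\cdot q)\times q)$ over the probability distributions $q$ supported in $S$, where $(W\times q)(x,y)=W_x(y)q(x)$ and $(W\cdot q)(y)=\sum_xW_x(y)q(x)$; the channel capacity is $C(\mathcal X)$. **The unconstrained solution.** For nonempty $S\subseteq\mathcal X$ let $\mathcal Y_S=\{y: W_x(y)>0\text{ for some }x\in S\}$ (so $\mathcal Y_S=\mathcal Y$ if all $W_x(y)>0$). Choose $x_0\in S$ and linearly independent functions $f_1,\dots,f_{m}$ on $\mathcal Y_S$, $m=|\mathcal Y_S|-1$, with $\sum_y f_j(y)W_{x_0}(y)=0$ and whose span contains no nonzero constant function. Put $h_{x,j}=\sum_y f_j(y)W_x(y)$ and $F(\theta)=\log\sum_{y\in\mathcal Y_S}e^{\sum_j\theta^jf_j(y)}$.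 Let $\bar\theta$ minimize $F$ on $\{\theta\in\mathbb R^m:\sum_jh_{x,j}\theta^j=-H(W_x)+H(W_{x_0})\ \forall x\in S\}$, and let $\bar P(y)=e^{\sum_j\bar\theta^jf_j(y)-F(\bar\theta)}$ on $\mathcal Y_S$ and $\bar P(y)=0$ elsewhere. The unconstrained solution is the real function $v_S$ on $S$, possibly with negative values, with $\sum_{x\in S}v_S(x)=1$ and $\sum_{x\in S}v_S(x)W_x=\bar P$. Put $\hat C(S)=-H(W_{x_0})+F(\bar\theta)$ and $\mathcal N(S)=\{x\in S:v_S(x)<0\}$; by convention $\hat C(\emptyset)=0$ and $\mathcal N(\emptyset)=\emptyset$. **The algorithm.** If $\mathcal N(\mathcal X)=\emptyset$, output $\hat C(\mathcal X)$. Otherwise let $\mathcal A_1=\{\{x\}:x\in\mathcal N(\mathcal X)\}$ and $\mathcal B^1=\{\{x\}:x\in\mathcal X,\ \mathcal N(\mathcal X\setminus\{x\})=\emptyset\}$, and for $j\ge1$, with $C^j=\max_{\mathcal X_1\in\mathcal B^j}\hat C(\mathcal X\setminus\mathcal X_1)$ ($-\infty$ if $\mathcal B^j=\emptyset$), let $\mathcal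 A_{j+1}$ be the family of all $\mathcal X_1\cup\{x\}$ with $$\mathcal X_1\in\mathcal A_j,\quad x\in\mathcal N(\mathcal X\setminus\mathcal X_1),\quad \mathcal N(\mathcal X\setminus(\mathcal X_1\cup\{x\}))\ne\emptyset,\quad \hat C(\mathcal X\setminus(\mathcal X_1\cup\{x\}))>C^j,$$ and let $\mathcal B^{j+1}=\mathcal B^j\cup\{\mathcal X_1\cup\{x\}:\mathcal X_1\in\mathcal A_j,\ x\in\mathcal X\setminus\mathcal X_1,\ \mathcal N(\mathcal X\setminus(\mathcal X_1\cup\{x\}))=\emptyset\}$. Stop at the first $j_0\ge2$ with $\mathcal A_{j_0}=\emptyset$ and output $C^{j_0}$. **Claims.** 1. For every nonempty $S\subseteq\mathcal X$ there is a unique input distribution $q^{S}$ that attains $C(S)$; admissible $(x_0,f_1,\dots,f_m)$ exist; and for each of them $\bar\theta$ and $v_S$ exist and are unique. Whatever these choices are (one for each $S$), the following holds. 2. If $S\ne\emptyset$ and $\mathcal N(S)=\emptyset$, then $\hat C(S)=C(S)$. 3. For every $S\subseteq\mathcal X$ with $\mathcal N(S)\ne\emptyset$, $\ (S\setminus\operatorname{supp}q^{S})\cap\mathcal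 N(S)\neq\emptyset$. 4. Suppose $\mathcal N(\mathcal X)\neq\emptyset$, and let $\mathcal X_*=\operatorname{supp}q^{\mathcal X}$. For every $j\ge1$ there is $\mathcal X_1\in\mathcal A_j\cup\mathcal B^j$ with $\mathcal X_*\subseteq\mathcal X\setminus\mathcal X_1$. If $\mathcal A_j=\emptyset$, there is such an $\mathcal X_1$ in $\mathcal B^j$, and for every $\mathcal X_1\in\mathcal B^j$ that maximizes $\hat C(\mathcal X\setminus\mathcal X_1)$ over $\mathcal B^j$ one has $\mathcal X_*=\{x\in\mathcal X\setminus\mathcal X_1: v_{\mathcal X\setminus\mathcal X_1}(x)>0\}$; in particular $\mathcal X_*=\mathcal X\setminus\mathcal X_1$ if $v_{\mathcal X\setminus\mathcal X_1}$ has no zero value. 5. The algorithm always stops, and its output is the channel capacity $C(\mathcal X)$. -/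

import Mathlib

namespace ChannelCapacity

noncomputable section

/-! A channel from `X` to `Y` is a family `W` of probability vectors `W x` on `Y`. -/

/-- Every `W x` is a probability distribution on `Y`. -/
def IsChannel {X Y : Type*} [Fintype Y] (W : X → Y → ℝ) : Prop :=
  ∀ x, W x ∈ stdSimplex ℝ Y

/-- Shannon entropy (natural logarithm). -/
def entropy {Ω : Type*} [Fintype Ω] (p : Ω → ℝ) : ℝ :=
  -∑ ω, p ω * Real.log (p ω)

/-- The finite-sum formula for `D(p‖q)`. It is used only where `q ω = 0` implies `p ω = 0`. -/
def relEntropy {Ω : Type*} [Fintype Ω] (p q : Ω → ℝ) : ℝ :=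
  ∑ ω, p ω * (Real.log (p ω) - Real.log (q ω))

/-- The output distribution `W · q`. -/
def outputDist {X Y : Type*} [Fintype X] (W : X → Y → ℝ) (q : X → ℝ) (y : Y) : ℝ :=
  ∑ x, W x y * q x

/-- The divergence `D(W × q ‖ (W · q) × q)`. -/
def mutualInfo {X Y : Type*} [Fintype X] [Fintype Y] (W : X → Y → ℝ) (q : X → ℝ) : ℝ :=
  relEntropy (fun z : X × Y => W z.1 z.2 * q z.1)
    (fun z : X × Y => outputDist W q z.2 * q z.1)

/-- The probability distributions on `S`, extended by zero to `X`. -/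
def inputsOn {X : Type*} [Fintype X] (S : Set X) : Set (X → ℝ) :=
  {q | q ∈ stdSimplex ℝ X ∧ ∀ x, x ∉ S → q x = 0}

/-- The capacity `C(S)` of the channel restricted to the inputs in `S`. -/
def capacity {X Y : Type*} [Fintype X] [Fintype Y] (W : X → Y → ℝ) (S : Set X) : ℝ :=
  sSup (mutualInfo W '' inputsOn S)

/-- `q` is an input distribution that attains the capacity of the channel restricted to `S`. -/
def IsOptimalInput {X Y : Type*} [Fintype X] [Fintype Y] (W : X → Y → ℝ) (S : Set X)
    (q : X → ℝ) : Prop :=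
  q ∈ inputsOn S ∧ IsMaxOn (mutualInfo W) (inputsOn S) q

open Classical in
/-- The output alphabet of the channel restricted to `S`: the outputs that have positive
probability under some input in `S` (all of `Y` if every `W x y` is positive). -/
def outputs {X Y : Type*} [Fintype Y] (W : X → Y → ℝ) (S : Set X) : Finset Y :=
  Finset.univ.filter fun y => ∃ x ∈ S, 0 < W x y

/-- The data chosen for the channel restricted to `S`: a reference input and a maximal
linearly independent system of functions on the output alphabet that have mean zero under the
reference distribution and whose span contains no nonzero constant. -/
structure OutputCoordinates {X Y : Type*} [Fintype Y] (W : X → Y → ℝ) (S : Set X) where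
  base : X
  base_mem : base ∈ S
  f : Fin ((outputs W S).card - 1) → outputs W S → ℝ
  linearIndependent : LinearIndependent ℝ f
  mean_zero : ∀ j, ∑ y, f j y * W base y = 0
  one_notMem : (fun _ => (1 : ℝ)) ∉ Submodule.span ℝ (Set.range f)

namespace OutputCoordinates

variable {X Y : Type*} [Fintype Y] {W : X → Y → ℝ} {S : Set X}

/-- The matrix `h x j = ∑ y, f j y * W x y`. -/
def h (c : OutputCoordinates W S) (x : X) (j : Fin ((outputs W S).card - 1)) : ℝ :=
  ∑ y, c.f j y * W x y

/-- The potential `F(θ) = log ∑ y, exp (∑ j, θ j * f j y)`. -/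
def potential (c : OutputCoordinates W S) (θ : Fin ((outputs W S).card - 1) → ℝ) : ℝ :=
  Real.log (∑ y, Real.exp (∑ j, θ j * c.f j y))

open Classical in
/-- The exponential family generated by the `f j`, as distributions on `Y`. -/
def expDist (c : OutputCoordinates W S) (θ : Fin ((outputs W S).card - 1) → ℝ) (y : Y) : ℝ :=
  if hy : y ∈ outputs W S then
    Real.exp (∑ j, θ j * c.f j ⟨y, hy⟩ - c.potential θ)
  else 0

/-- The affine space of parameters `θ` with `∑ j, h x j * θ j = -H(W x) + H(W base)`, `x ∈ S`. -/
def family (c : OutputCoordinates W S) : Set (Fin ((outputs W S).card - 1) → ℝ) :=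
  {θ | ∀ x ∈ S, ∑ j, c.h x j * θ j = -entropy (W x) + entropy (W c.base)}

/-- `θ` minimizes the potential on `family`. -/
def IsMinimizer (c : OutputCoordinates W S) (θ : Fin ((outputs W S).card - 1) → ℝ) : Prop :=
  θ ∈ c.family ∧ IsMinOn c.potential c.family θ

/-- The minimizer of the potential on `family`. -/
def minimizer (c : OutputCoordinates W S) : Fin ((outputs W S).card - 1) → ℝ :=
  Classical.epsilon c.IsMinimizer

/-- The value `-H(W base) + F(θ)` at the minimizer. -/
def value (c : OutputCoordinates W S) : ℝ :=
  -entropy (W c.base) + c.potential c.minimizer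

variable [Fintype X]

/-- `v` is a (possibly negative) function on `S`, extended by zero, with total mass one, such that
`∑ x, v x * W x` is the distribution at the minimizer. -/
def IsSolution (c : OutputCoordinates W S) (v : X → ℝ) : Prop :=
  (∀ x, x ∉ S → v x = 0) ∧ ∑ x, v x = 1 ∧ ∀ y, ∑ x, v x * W x y = c.expDist c.minimizer y

/-- The unconstrained solution. -/
def solution (c : OutputCoordinates W S) : X → ℝ :=
  Classical.epsilon c.IsSolution

end OutputCoordinates

/-- A choice of coordinates for each nonempty set of inputs. -/
abbrev CoordinateChoice {X Y : Type*} [Fintype Y] (W : X → Y → ℝ) :=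
  ∀ S : Set X, S.Nonempty → OutputCoordinates W S

section Algorithm

variable {X Y : Type*} [Fintype X] [Fintype Y] {W : X → Y → ℝ}

open Classical in
/-- `Ĉ(S)`; the value at the empty set is a convention. -/
def cHat (κ : CoordinateChoice W) (S : Set X) : ℝ :=
  if hS : S.Nonempty then (κ S hS).value else 0

open Classical in
/-- The unconstrained solution for `S`. -/
def unconstrained (κ : CoordinateChoice W) (S : Set X) : X → ℝ :=
  if hS : S.Nonempty then (κ S hS).solution else 0

/-- `N(S)`: the inputs in `S` at which the unconstrained solution for `S` is negative. -/
def negSet (κ : CoordinateChoice W) (S : Set X) : Set X :=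
  {x | x ∈ S ∧ unconstrained κ S x < 0}

/-- The new candidates `X₁ ∪ {x}` with `X₁ ∈ A`, `x ∉ X₁` and `N(X \ (X₁ ∪ {x})) = ∅`. -/
def newB (κ : CoordinateChoice W) (A : Set (Set X)) : Set (Set X) :=
  {Z | ∃ X₁ ∈ A, ∃ x ∈ X₁ᶜ, negSet κ (insert x X₁)ᶜ = ∅ ∧ Z = insert x X₁}

/-- The maximum of `Ĉ(X \ X₁)` over `X₁ ∈ B`; it is `-∞` if `B` is empty. -/
def maxOver (κ : CoordinateChoice W) (B : Set (Set X)) : EReal :=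
  ⨆ X₁ ∈ B, ((cHat κ X₁ᶜ : ℝ) : EReal)

/-- The sets `X₁ ∪ {x}` with `X₁ ∈ A`, `x ∈ N(X \ X₁)`, `N(X \ (X₁ ∪ {x})) ≠ ∅` and
`Ĉ(X \ (X₁ ∪ {x})) > C`. -/
def newA (κ : CoordinateChoice W) (A : Set (Set X)) (C : EReal) : Set (Set X) :=
  {Z | ∃ X₁ ∈ A, ∃ x ∈ negSet κ X₁ᶜ, (negSet κ (insert x X₁)ᶜ).Nonempty ∧
    C < ((cHat κ (insert x X₁)ᶜ : ℝ) : EReal) ∧ Z = insert x X₁}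

/-- The pair of families (`A` with index `j`, cumulative `B` with upper index `j`).
The rounds of the algorithm are `j ≥ 1`; the entry `j = 0` is the state before the first round. -/
def round (κ : CoordinateChoice W) : ℕ → Set (Set X) × Set (Set X)
  | 0 => ({∅}, ∅)
  | 1 => ({Z | ∃ x ∈ negSet κ Set.univ, Z = {x}}, newB κ {∅})
  | j + 2 => (newA κ (round κ (j + 1)).1 (maxOver κ (round κ (j + 1)).2),
      (round κ (j + 1)).2 ∪ newB κ (round κ (j + 1)).1)

/-- The family `A` with index `j`. -/
def familyA (κ : CoordinateChoice W) (j : ℕ) : Set (Set X) := (round κ j).1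

/-- The cumulative family `B` with upper index `j`. -/
def familyB (κ : CoordinateChoice W) (j : ℕ) : Set (Set X) := (round κ j).2

/-- `j` is the first index `j ≥ 2` at which the family `A` is empty. -/
def StopsAt (κ : CoordinateChoice W) (j : ℕ) : Prop :=
  2 ≤ j ∧ familyA κ j = ∅ ∧ ∀ i, 2 ≤ i → i < j → (familyA κ i).Nonempty

/-- The algorithm stops and outputs `c`. -/
def Outputs (κ : CoordinateChoice W) (c : EReal) : Prop :=
  (negSet κ Set.univ = ∅ ∧ c = ((cHat κ Set.univ : ℝ) : EReal)) ∨
  ((negSet κ Set.univ).Nonempty ∧ ∃ j, StopsAt κ j ∧ c = maxOver κ (familyB κ j))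

end Algorithm

end

end ChannelCapacity

/-! In coordinate-free form, the minimization of `F` seeks a function `r` on the outputs with
prescribed pairings with the `W x` and least `∑ exp r`. Strict convexity gives one minimizer, and
stationarity puts `exp r` in the span of the `W x`; the normalized coefficients are `v_S`. The
constraints say exactly that `D(W x ‖ P̄) = Ĉ(S)` for every `x ∈ S`.

The compensation identity then gives `I(q) = Ĉ(S) - D(W·q ‖ P̄)` for every input distribution `q` on
`S`. So `I ≤ Ĉ(S)`, with equality only at `q = v_S`, and a nonnegative `v_S` is optimal. Conversely,
the Kuhn–Tucker conditions at the optimal `q` (`D(W x ‖ W·q) ≤ I(q)`, with equality on the support)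
can be averaged with the signed weights `v_S`: if `v_S` is nonnegative off the support of `q`, then
`Ĉ(S) ≤ I(q)`, hence `q = v_S` (`IsEqualizer.eq_of_isOptimalInput`). Therefore a `v_S` with negative
values is negative at some input that `q` does not use.

The optimal input for `X` stays optimal on every `S` containing its support, so such unused inputs
can be removed one at a time. The bound `Ĉ(S) > C(X)` along this chain keeps it from being pruned,
and cardinality ends it at a candidate whose value is the capacity
(`exists_mem_familyB_or_familyA`). -/

namespace ChannelCapacity

/-! ### Minimizing a sum of exponentials under linear constraints. -/

section ExpSum

variable {ι Z : Type*} [Fintype Z]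

/-- The affine space of functions with prescribed pairings with the vectors `w i`. -/
def pairingSet (w : ι → Z → ℝ) (b : ι → ℝ) : Set (Z → ℝ) :=
  {r | ∀ i, ∑ z, r z * w i z = b i}

theorem pairingSet_nonempty {w : ι → Z → ℝ} (hw : LinearIndependent ℝ w) (b : ι → ℝ) :
    (pairingSet w b).Nonempty := by
  classical
  let B := Module.Basis.span hw
  obtain ⟨φ, hφ⟩ := (B.constr ℝ b).exists_extend
  have hφw : ∀ i, φ (w i) = b i := by
    intro i
    have h1 : φ (B i : Z → ℝ) = B.constr ℝ b (B i) := by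
      rw [← hφ]; rfl
    rw [Module.Basis.constr_basis] at h1
    rwa [Module.Basis.span_apply] at h1
  refine ⟨fun z => φ (Pi.single z 1), fun i => ?_⟩
  rw [← hφw i]
  conv_rhs => rw [pi_eq_sum_univ' (w i)]
  rw [map_sum]
  refine Finset.sum_congr rfl fun z _ => ?_
  rw [map_smul, smul_eq_mul, mul_comm]

/-- On the functions with prescribed pairings with nonnegative vectors that cover `Z`,
the sum of exponentials attains its minimum. -/
theorem exists_isMinOn_sum_exp {w : ι → Z → ℝ} {b : ι → ℝ} (hw : ∀ i z, 0 ≤ w i z)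
    (hcov : ∀ z, ∃ i, 0 < w i z) (hne : (pairingSet w b).Nonempty) :
    ∃ r ∈ pairingSet w b, IsMinOn (fun r : Z → ℝ => ∑ z, Real.exp (r z)) (pairingSet w b) r := by
  classical
  obtain ⟨r₀, hr₀⟩ := hne
  set E : (Z → ℝ) → ℝ := fun r => ∑ z, Real.exp (r z) with hE
  have hEc : Continuous E := by fun_prop
  let K : Set (Z → ℝ) := pairingSet w b ∩ {r | E r ≤ E r₀}
  have hGc : IsClosed (pairingSet w b) := by
    rw [pairingSet, Set.ofPred_forall]
    exact isClosed_iInter fun i => isClosed_eq (by fun_prop) (by fun_prop)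
  have hKc : IsClosed K := hGc.inter (isClosed_le hEc continuous_const)
  choose i hi using hcov
  have hub : ∀ r ∈ K, ∀ z, r z ≤ E r₀ := by
    intro r hr z
    calc r z ≤ Real.exp (r z) := by linarith [Real.add_one_le_exp (r z)]
      _ ≤ E r := Finset.single_le_sum (f := fun z => Real.exp (r z))
          (fun _ _ => (Real.exp_pos _).le) (Finset.mem_univ z)
      _ ≤ E r₀ := hr.2
  -- A constraint with positive weight at `z` bounds `r z` from below, since the other coordinates
  -- are bounded above and enter with nonnegative weights.
  have hlb : ∀ r ∈ K, ∀ z,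
      (b (i z) - ∑ y ∈ Finset.univ.erase z, E r₀ * w (i z) y) / w (i z) z ≤ r z := by
    intro r hr z
    rw [div_le_iff₀ (hi z), ← hr.1 (i z), ← Finset.add_sum_erase _ _ (Finset.mem_univ z)]
    have : ∑ y ∈ Finset.univ.erase z, r y * w (i z) y
        ≤ ∑ y ∈ Finset.univ.erase z, E r₀ * w (i z) y :=
      Finset.sum_le_sum fun y _ => mul_le_mul_of_nonneg_right (hub r hr y) (hw _ _)
    linarith
  have hK : IsCompact K :=
    isCompact_Icc.of_isClosed_subset hKc fun r hr => ⟨hlb r hr, hub r hr⟩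
  obtain ⟨r, hr, hmin⟩ := hK.exists_isMinOn ⟨r₀, hr₀, le_refl (E r₀)⟩ hEc.continuousOn
  refine ⟨r, hr.1, fun r' hr' => ?_⟩
  by_cases h : E r' ≤ E r₀
  · exact hmin ⟨hr', h⟩
  · exact hr.2.trans (not_le.mp h).le

theorem isMinOn_sum_exp_unique {w : ι → Z → ℝ} {b : ι → ℝ} {r s : Z → ℝ}
    (hr : r ∈ pairingSet w b) (hs : s ∈ pairingSet w b)
    (hrm : IsMinOn (fun r : Z → ℝ => ∑ z, Real.exp (r z)) (pairingSet w b) r)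
    (hsm : IsMinOn (fun r : Z → ℝ => ∑ z, Real.exp (r z)) (pairingSet w b) s) : r = s := by
  by_contra hne
  have hconv : ∀ z, Real.exp ((1 / 2 : ℝ) * r z + (1 / 2 : ℝ) * s z)
      ≤ (1 / 2 : ℝ) * Real.exp (r z) + (1 / 2 : ℝ) * Real.exp (s z) := fun z =>
    convexOn_exp.2 (Set.mem_univ _) (Set.mem_univ _) (by norm_num) (by norm_num) (by norm_num)
  obtain ⟨z₀, hz₀⟩ := Function.ne_iff.mp hne
  have hlt : ∑ z, Real.exp ((1 / 2 : ℝ) * r z + (1 / 2 : ℝ) * s z)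
      < ∑ z, ((1 / 2 : ℝ) * Real.exp (r z) + (1 / 2 : ℝ) * Real.exp (s z)) :=
    Finset.sum_lt_sum (fun z _ => hconv z) ⟨z₀, Finset.mem_univ _,
      strictConvexOn_exp.2 (Set.mem_univ _) (Set.mem_univ _) hz₀ (by norm_num) (by norm_num)
        (by norm_num)⟩
  rw [Finset.sum_add_distrib, ← Finset.mul_sum, ← Finset.mul_sum] at hlt
  have hmid : (fun z => (1 / 2 : ℝ) * r z + (1 / 2 : ℝ) * s z) ∈ pairingSet w b := by
    intro i
    have h1 := hr i
    have h2 := hs i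
    simp only [add_mul, mul_assoc, Finset.sum_add_distrib, ← Finset.mul_sum, h1, h2]
    ring
  have h1 := isMinOn_iff.mp hrm _ hmid
  have h2 := isMinOn_iff.mp hsm _ hmid
  linarith

/-- At a minimum of the sum of exponentials, the vector of exponentials is a linear combination
of the constraint vectors. -/
theorem exists_exp_eq_of_isMinOn [Fintype ι] {w : ι → Z → ℝ} {b : ι → ℝ} {r : Z → ℝ}
    (hr : r ∈ pairingSet w b)
    (hrm : IsMinOn (fun r : Z → ℝ => ∑ z, Real.exp (r z)) (pairingSet w b) r) :
    ∃ v : ι → ℝ, ∀ z, Real.exp (r z) = ∑ i, v i * w i z := by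
  classical
  have hstat : ∀ δ : Z → ℝ, (∀ i, ∑ z, δ z * w i z = 0) → ∑ z, Real.exp (r z) * δ z = 0 := by
    intro δ hδ
    have hd : HasDerivAt (fun t : ℝ => ∑ z, Real.exp (r z + t * δ z))
        (∑ z, Real.exp (r z + 0 * δ z) * (1 * δ z)) 0 :=
      HasDerivAt.fun_sum fun z _ => (((hasDerivAt_id (0 : ℝ)).mul_const (δ z)).const_add (r z)).exp
    have hmin : IsLocalMin (fun t : ℝ => ∑ z, Real.exp (r z + t * δ z)) 0 := by
      refine Filter.Eventually.of_forall fun t => ?_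
      have hmem : (fun z => r z + t * δ z) ∈ pairingSet w b := by
        intro i
        have h1 := hr i
        have h2 := hδ i
        simp only [add_mul, mul_assoc, Finset.sum_add_distrib, ← Finset.mul_sum, h1, h2]
        ring
      simpa using hrm hmem
    simpa using hmin.hasDerivAt_eq_zero hd
  -- Duality: a functional that kills all `w i` but not `exp r` would be a feasible direction
  -- violating `hstat`.
  have hmem : (fun z => Real.exp (r z)) ∈ Submodule.span ℝ (Set.range w) := by
    by_contra hnot
    obtain ⟨φ, hφ, hle⟩ := Submodule.exists_le_ker_of_notMem hnot
    have hφs : ∀ g : Z → ℝ, φ g = ∑ z, φ (Pi.single z 1) * g z := by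
      intro g
      conv_lhs => rw [pi_eq_sum_univ' g]
      rw [map_sum]
      refine Finset.sum_congr rfl fun z _ => ?_
      rw [map_smul, smul_eq_mul, mul_comm]
    refine hφ ?_
    rw [hφs]
    simp_rw [mul_comm (φ _)]
    refine hstat _ fun i => ?_
    rw [← hφs]
    exact hle (Submodule.subset_span ⟨i, rfl⟩)
  obtain ⟨v, hv⟩ := (Submodule.mem_span_range_iff_exists_fun ℝ).mp hmem
  exact ⟨v, fun z => by simpa using (congrFun hv z).symm⟩

end ExpSum

/-! ### Existence and uniqueness of the minimizer and of the unconstrained solution. -/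

section Outputs

variable {X Y : Type*} [Fintype Y] {W : X → Y → ℝ} {S : Set X}

theorem mem_outputs {y : Y} : y ∈ outputs W S ↔ ∃ x ∈ S, 0 < W x y := by
  simp [outputs]

theorem eq_zero_of_notMem_outputs (hW : IsChannel W) {x : X} (hx : x ∈ S) {y : Y}
    (hy : y ∉ outputs W S) : W x y = 0 :=
  le_antisymm (not_lt.mp fun h => hy (mem_outputs.mpr ⟨x, hx, h⟩)) ((hW x).1 y)

theorem sum_outputs_mul (hW : IsChannel W) {x : X} (hx : x ∈ S) (g : Y → ℝ) :
    ∑ y : outputs W S, g y * W x y = ∑ y, g y * W x y := by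
  rw [Finset.sum_coe_sort (outputs W S) fun y => g y * W x y]
  refine Finset.sum_subset (Finset.subset_univ _) fun y _ hy => ?_
  rw [eq_zero_of_notMem_outputs hW hx hy, mul_zero]

theorem sum_outputs (hW : IsChannel W) {x : X} (hx : x ∈ S) :
    ∑ y : outputs W S, W x y = 1 := by
  have h := sum_outputs_mul hW hx fun _ => 1
  simp only [one_mul] at h
  rw [h, (hW x).2]

/-- The inputs in `S`, as vectors on the output alphabet of `S`. -/
noncomputable def restricted (W : X → Y → ℝ) (S : Set X) (x : S) (y : outputs W S) : ℝ := W x y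

theorem linearIndependent_restricted (hW : IsChannel W) (hli : LinearIndependent ℝ W) :
    LinearIndependent ℝ (restricted W S) := by
  rw [linearIndependent_iff']
  intro s g hg i hi
  refine linearIndependent_iff'.mp (hli.comp ((↑) : S → X) Subtype.val_injective) s g ?_ i hi
  ext y
  by_cases hy : y ∈ outputs W S
  · simpa [restricted] using congrFun hg ⟨y, hy⟩
  · simp only [Finset.sum_apply, Pi.smul_apply, Function.comp_apply, smul_eq_mul, Pi.zero_apply]
    exact Finset.sum_eq_zero fun x _ => by rw [eq_zero_of_notMem_outputs hW x.2 hy, mul_zero]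

/-- The pairing with the reference input. -/
noncomputable def basePairing (W : X → Y → ℝ) (S : Set X) (x : X) : (outputs W S → ℝ) →ₗ[ℝ] ℝ where
  toFun g := ∑ y, g y * W x y
  map_add' g g' := by simp [add_mul, Finset.sum_add_distrib]
  map_smul' a g := by simp [mul_assoc, Finset.mul_sum]

theorem basePairing_apply (x : X) (g : outputs W S → ℝ) :
    basePairing W S x g = ∑ y, g y * W x y := rfl

theorem finrank_ker_basePairing (hW : IsChannel W) {x : X} (hx : x ∈ S) :
    Module.finrank ℝ (LinearMap.ker (basePairing W S x)) = (outputs W S).card - 1 := by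
  have hne : basePairing W S x ≠ 0 := by
    intro h
    have h1 := LinearMap.congr_fun h fun _ => 1
    rw [basePairing_apply] at h1
    simp only [one_mul] at h1
    rw [sum_outputs hW hx] at h1
    exact one_ne_zero h1
  have h := Module.Dual.finrank_ker_add_one_of_ne_zero hne
  rw [Module.finrank_fintype_fun_eq_card, Fintype.card_coe] at h
  omega

theorem nonempty_outputCoordinates (hW : IsChannel W) (hS : S.Nonempty) :
    Nonempty (OutputCoordinates W S) := by
  obtain ⟨x, hx⟩ := hS
  let B := Module.finBasisOfFinrankEq ℝ _ (finrank_ker_basePairing hW hx)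
  have hker : ∀ g ∈ Submodule.span ℝ (Set.range fun j => (B j : outputs W S → ℝ)),
      ∑ y, g y * W x y = 0 := by
    intro g hg
    have hle : Submodule.span ℝ (Set.range fun j => (B j : outputs W S → ℝ))
        ≤ LinearMap.ker (basePairing W S x) := by
      rw [Submodule.span_le]
      rintro _ ⟨j, rfl⟩
      exact (B j).2
    exact hle hg
  refine ⟨⟨x, hx, fun j => (B j : outputs W S → ℝ), ?_, fun j => (B j).2, fun h => ?_⟩⟩
  · exact B.linearIndependent.map' (Submodule.subtype _) (Submodule.ker_subtype _)
  · have := hker _ h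
    simp only [one_mul] at this
    rw [sum_outputs hW hx] at this
    exact one_ne_zero this

namespace OutputCoordinates

variable (c : OutputCoordinates W S)

/-- The function `∑ j, θ j * f j`. -/
noncomputable def comb (θ : Fin ((outputs W S).card - 1) → ℝ) (y : outputs W S) : ℝ :=
  ∑ j, θ j * c.f j y

theorem comb_eq_sum_smul (θ : Fin ((outputs W S).card - 1) → ℝ) :
    c.comb θ = ∑ j, θ j • c.f j := by
  ext y
  simp [comb]

theorem comb_injective : Function.Injective c.comb := by
  intro θ θ' h
  rw [comb_eq_sum_smul, comb_eq_sum_smul, ← sub_eq_zero, ← Finset.sum_sub_distrib] at h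
  simp_rw [← sub_smul] at h
  exact funext fun j => sub_eq_zero.mp (Fintype.linearIndependent_iff.mp c.linearIndependent _ h j)

/-- The `f j` are as many independent vectors as the dimension of the mean-zero hyperplane, hence a
basis of it. -/
theorem exists_comb_eq (hW : IsChannel W) {g : outputs W S → ℝ}
    (hg : ∑ y, g y * W c.base y = 0) : ∃ θ, c.comb θ = g := by
  have hle : Submodule.span ℝ (Set.range c.f) ≤ LinearMap.ker (basePairing W S c.base) := by
    rw [Submodule.span_le]
    rintro _ ⟨j, rfl⟩
    exact c.mean_zero j
  have heq : Submodule.span ℝ (Set.range c.f) = LinearMap.ker (basePairing W S c.base) := by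
    refine Submodule.eq_of_le_of_finrank_eq hle ?_
    rw [finrank_ker_basePairing hW c.base_mem, finrank_span_eq_card c.linearIndependent,
      Fintype.card_fin]
  have hmem : g ∈ Submodule.span ℝ (Set.range c.f) := by
    rw [heq]
    exact hg
  obtain ⟨θ, hθ⟩ := (Submodule.mem_span_range_iff_exists_fun ℝ).mp hmem
  exact ⟨θ, by rw [comb_eq_sum_smul, hθ]⟩

/-- The right-hand sides of the equations that define `family`. -/
noncomputable def target (x : S) : ℝ := -entropy (W x) + entropy (W c.base)

theorem mem_family_iff {θ : Fin ((outputs W S).card - 1) → ℝ} :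
    θ ∈ c.family ↔ c.comb θ ∈ pairingSet (restricted W S) c.target := by
  have h : ∀ x, ∑ j, c.h x j * θ j = ∑ y, c.comb θ y * W x y := by
    intro x
    simp only [OutputCoordinates.h, comb, Finset.sum_mul]
    rw [Finset.sum_comm]
    exact Finset.sum_congr rfl fun y _ => Finset.sum_congr rfl fun j _ => by ring
  simp only [family, pairingSet, Set.mem_ofPred_eq, h, Subtype.forall, restricted, target]

theorem exists_comb_eq_of_mem (hW : IsChannel W) {g : outputs W S → ℝ}
    (hg : g ∈ pairingSet (restricted W S) c.target) : ∃ θ ∈ c.family, c.comb θ = g := by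
  obtain ⟨θ, rfl⟩ := c.exists_comb_eq hW (g := g) <| by
    -- At the base input the prescribed pairing is `0`, so `g` has mean zero.
    have h := hg ⟨c.base, c.base_mem⟩
    simpa [restricted, target] using h
  exact ⟨θ, c.mem_family_iff.mpr hg, rfl⟩

theorem sum_exp_pos (c : OutputCoordinates W S) (hW : IsChannel W) (g : outputs W S → ℝ) : 0 < ∑ y, Real.exp (g y) := by
  have : Nonempty (outputs W S) := by
    by_contra h
    rw [not_nonempty_iff] at h
    simpa using sum_outputs hW c.base_mem
  exact Finset.sum_pos (fun _ _ => Real.exp_pos _) Finset.univ_nonempty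

/-- Removes the coordinates: `comb` maps `family` onto `pairingSet`, and the logarithm preserves
order. -/
theorem isMinimizer_iff (hW : IsChannel W) {θ : Fin ((outputs W S).card - 1) → ℝ} :
    c.IsMinimizer θ ↔ c.comb θ ∈ pairingSet (restricted W S) c.target ∧
      IsMinOn (fun r => ∑ y, Real.exp (r y)) (pairingSet (restricted W S) c.target)
        (c.comb θ) := by
  have hlog : ∀ θ θ', c.potential θ ≤ c.potential θ' ↔
      ∑ y, Real.exp (c.comb θ y) ≤ ∑ y, Real.exp (c.comb θ' y) := fun θ θ' =>
    Real.log_le_log_iff (c.sum_exp_pos hW _) (c.sum_exp_pos hW _)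
  rw [IsMinimizer, mem_family_iff, isMinOn_iff, isMinOn_iff]
  refine and_congr_right fun _ => ⟨fun h g hg => ?_, fun h θ' hθ' => ?_⟩
  · obtain ⟨θ', hθ', rfl⟩ := c.exists_comb_eq_of_mem hW hg
    exact (hlog _ _).mp (h θ' hθ')
  · exact (hlog _ _).mpr (h _ (c.mem_family_iff.mp hθ'))

theorem existsUnique_isMinimizer (hW : IsChannel W) (hli : LinearIndependent ℝ W) :
    ∃! θ, c.IsMinimizer θ := by
  obtain ⟨r, hr, hmin⟩ := exists_isMinOn_sum_exp (w := restricted W S) (b := c.target)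
    (fun x y => (hW x).1 y)
    (fun y => by
      obtain ⟨x, hx, h⟩ := mem_outputs.mp y.2
      exact ⟨⟨x, hx⟩, h⟩)
    (pairingSet_nonempty (linearIndependent_restricted hW hli) _)
  obtain ⟨θ, -, rfl⟩ := c.exists_comb_eq_of_mem hW hr
  refine ⟨θ, (c.isMinimizer_iff hW).mpr ⟨hr, hmin⟩, fun θ' hθ' => ?_⟩
  obtain ⟨h1, h2⟩ := (c.isMinimizer_iff hW).mp hθ'
  exact c.comb_injective (isMinOn_sum_exp_unique h1 hr h2 hmin)

theorem isMinimizer_minimizer (hW : IsChannel W) (hli : LinearIndependent ℝ W) :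
    c.IsMinimizer c.minimizer :=
  Classical.epsilon_spec (c.existsUnique_isMinimizer hW hli).exists

theorem expDist_of_mem {θ : Fin ((outputs W S).card - 1) → ℝ} {y : Y} (hy : y ∈ outputs W S) :
    c.expDist θ y = Real.exp (c.comb θ ⟨y, hy⟩ - c.potential θ) := by
  simp [expDist, hy, comb]

theorem expDist_of_notMem {θ : Fin ((outputs W S).card - 1) → ℝ} {y : Y}
    (hy : y ∉ outputs W S) : c.expDist θ y = 0 := by
  simp [expDist, hy]

theorem sum_expDist (hW : IsChannel W) (θ : Fin ((outputs W S).card - 1) → ℝ) :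
    ∑ y, c.expDist θ y = 1 := by
  have h1 : ∑ y, c.expDist θ y = ∑ y : outputs W S, c.expDist θ y := by
    rw [Finset.sum_coe_sort (outputs W S) fun y => c.expDist θ y]
    exact (Finset.sum_subset (Finset.subset_univ _)
      fun y _ hy => c.expDist_of_notMem hy).symm
  have hpos := c.sum_exp_pos hW (c.comb θ)
  have h2 : Real.exp (c.potential θ) = ∑ y, Real.exp (c.comb θ y) := Real.exp_log hpos
  rw [h1]
  simp_rw [fun y : outputs W S => c.expDist_of_mem (θ := θ) y.2, Real.exp_sub, h2,
    ← Finset.sum_div]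
  exact div_self hpos.ne'

/-- The distribution at the minimizer has the same divergence from all inputs in `S`. -/
theorem relEntropy_expDist (hW : IsChannel W) (hli : LinearIndependent ℝ W) {x : X}
    (hx : x ∈ S) : relEntropy (W x) (c.expDist c.minimizer) = c.value := by
  have hmem : ∑ y : outputs W S, c.comb c.minimizer y * W x y
      = -entropy (W x) + entropy (W c.base) :=
    c.mem_family_iff.mp (c.isMinimizer_minimizer hW hli).1 ⟨x, hx⟩
  have h1 : ∑ y, W x y * Real.log (c.expDist c.minimizer y)
      = ∑ y : outputs W S, (c.comb c.minimizer y - c.potential c.minimizer) * W x y := by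
    simp_rw [mul_comm (W x _)]
    rw [← sum_outputs_mul hW hx]
    refine Finset.sum_congr rfl fun y _ => ?_
    rw [c.expDist_of_mem y.2, Real.log_exp]
  simp_rw [sub_mul] at h1
  rw [Finset.sum_sub_distrib, hmem, ← Finset.mul_sum, sum_outputs hW hx] at h1
  simp_rw [relEntropy, mul_sub]
  rw [Finset.sum_sub_distrib, h1, value, entropy]
  ring

variable [Fintype X]

theorem existsUnique_isSolution (hW : IsChannel W) (hli : LinearIndependent ℝ W) :
    ∃! v, c.IsSolution v := by
  classical
  obtain ⟨hr, hmin⟩ := (c.isMinimizer_iff hW).mp (c.isMinimizer_minimizer hW hli)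
  obtain ⟨u, hu⟩ := exists_exp_eq_of_isMinOn hr hmin
  -- Dividing by the partition sum turns `exp r` into the distribution at the minimizer.
  let v : X → ℝ := fun x =>
    if hx : x ∈ S then u ⟨x, hx⟩ * Real.exp (-c.potential c.minimizer) else 0
  have hv0 : ∀ x, x ∉ S → v x = 0 := fun x hx => by simp [v, hx]
  have hvP : ∀ y, ∑ x, v x * W x y = c.expDist c.minimizer y := by
    intro y
    by_cases hy : y ∈ outputs W S
    · have h1 : ∑ x, v x * W x y = ∑ x : S, v x * W x y := by
        rw [Finset.sum_set_coe S (f := fun x => v x * W x y)]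
        refine (Finset.sum_subset (Finset.subset_univ _) fun x _ hx => ?_).symm
        rw [hv0 x (by simpa using hx), zero_mul]
      rw [h1, c.expDist_of_mem hy, sub_eq_add_neg, Real.exp_add, hu, Finset.sum_mul]
      refine Finset.sum_congr rfl fun x _ => ?_
      simp only [v, x.2, restricted, dite_true]
      ring
    · rw [c.expDist_of_notMem hy]
      refine Finset.sum_eq_zero fun x _ => ?_
      by_cases hx : x ∈ S
      · rw [eq_zero_of_notMem_outputs hW hx hy, mul_zero]
      · rw [hv0 x hx, zero_mul]
  -- Total mass one is automatic: sum the output equation over `y`.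
  have hv1 : ∑ x, v x = 1 := by
    rw [← c.sum_expDist hW c.minimizer]
    simp_rw [← hvP]
    rw [Finset.sum_comm]
    exact Finset.sum_congr rfl fun x _ => by rw [← Finset.mul_sum, (hW x).2, mul_one]
  refine ⟨v, ⟨hv0, hv1, hvP⟩, fun v' hv' => ?_⟩
  ext x
  refine sub_eq_zero.mp (Fintype.linearIndependent_iff.mp hli (fun x => v' x - v x) ?_ x)
  ext y
  simp only [Finset.sum_apply, Pi.smul_apply, smul_eq_mul, Pi.zero_apply, sub_mul,
    Finset.sum_sub_distrib]
  rw [hv'.2.2 y, hvP y, sub_self]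

theorem isSolution_solution (hW : IsChannel W) (hli : LinearIndependent ℝ W) :
    c.IsSolution c.solution :=
  Classical.epsilon_spec (c.existsUnique_isSolution hW hli).exists

end OutputCoordinates

end Outputs

/-! ### Gibbs' inequality, the compensation identity, and the unique optimal input. -/

section Divergence

variable {X Y : Type*} [Fintype X] [Fintype Y] {W : X → Y → ℝ} {S : Set X}

theorem sub_le_mul_log_sub_log {p r : ℝ} (hp : 0 ≤ p) (hr : 0 ≤ r) (h : r = 0 → p = 0) :
    p - r ≤ p * (Real.log p - Real.log r) := by
  rcases hp.eq_or_lt with rfl | hp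
  · simpa using hr
  have hr : 0 < r := hr.lt_of_ne fun h0 => hp.ne' (h h0.symm)
  have h1 := Real.log_le_sub_one_of_pos (div_pos hr hp)
  rw [Real.log_div hr.ne' hp.ne'] at h1
  have h2 := mul_le_mul_of_nonneg_left h1 hp.le
  rw [mul_sub p (r / p), mul_div_cancel₀ _ hp.ne'] at h2
  linarith

theorem sub_lt_mul_log_sub_log {p r : ℝ} (hp : 0 ≤ p) (hr : 0 ≤ r) (h : r = 0 → p = 0)
    (hne : p ≠ r) : p - r < p * (Real.log p - Real.log r) := by
  rcases hp.eq_or_lt with rfl | hp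
  · simpa using hr.lt_of_ne hne
  have hr : 0 < r := hr.lt_of_ne fun h0 => hp.ne' (h h0.symm)
  have h1 := Real.log_lt_sub_one_of_pos (div_pos hr hp)
    fun h1 => hne ((div_eq_one_iff_eq hp.ne').mp h1).symm
  rw [Real.log_div hr.ne' hp.ne'] at h1
  have h2 := mul_lt_mul_of_pos_left h1 hp
  rw [mul_sub p (r / p), mul_div_cancel₀ _ hp.ne'] at h2
  linarith

theorem relEntropy_nonneg {p r : Y → ℝ} (hp : p ∈ stdSimplex ℝ Y) (hr : r ∈ stdSimplex ℝ Y)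
    (h : ∀ y, r y = 0 → p y = 0) : 0 ≤ relEntropy p r := by
  calc (0 : ℝ) = ∑ y, (p y - r y) := by rw [Finset.sum_sub_distrib, hp.2, hr.2, sub_self]
    _ ≤ relEntropy p r :=
      Finset.sum_le_sum fun y _ => sub_le_mul_log_sub_log (hp.1 y) (hr.1 y) (h y)

theorem eq_of_relEntropy_le_zero {p r : Y → ℝ} (hp : p ∈ stdSimplex ℝ Y)
    (hr : r ∈ stdSimplex ℝ Y) (h : ∀ y, r y = 0 → p y = 0) (h0 : relEntropy p r ≤ 0) :
    p = r := by
  by_contra hne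
  obtain ⟨y, hy⟩ := Function.ne_iff.mp hne
  refine h0.not_gt ?_
  calc (0 : ℝ) = ∑ y, (p y - r y) := by rw [Finset.sum_sub_distrib, hp.2, hr.2, sub_self]
    _ < relEntropy p r :=
      Finset.sum_lt_sum (fun y _ => sub_le_mul_log_sub_log (hp.1 y) (hr.1 y) (h y))
        ⟨y, Finset.mem_univ _, sub_lt_mul_log_sub_log (hp.1 y) (hr.1 y) (h y) hy⟩

theorem relEntropy_eq (p r : Y → ℝ) :
    relEntropy p r = -entropy p - ∑ y, p y * Real.log (r y) := by
  simp [relEntropy, entropy, mul_sub, Finset.sum_sub_distrib]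

theorem entropy_eq_sum_negMulLog (p : Y → ℝ) : entropy p = ∑ y, Real.negMulLog (p y) := by
  simp [entropy, Real.negMulLog]

theorem sum_mul_relEntropy_eq (q : X → ℝ) (r : Y → ℝ) :
    ∑ x, q x * relEntropy (W x) r
      = -∑ x, q x * entropy (W x) - ∑ y, outputDist W q y * Real.log (r y) := by
  simp_rw [relEntropy_eq, mul_sub, Finset.sum_sub_distrib, outputDist, Finset.sum_mul,
    Finset.mul_sum]
  congr 1
  · simp
  · rw [Finset.sum_comm]
    exact Finset.sum_congr rfl fun y _ => Finset.sum_congr rfl fun x _ => by ring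

/-- The compensation identity. -/
theorem sum_mul_relEntropy (q : X → ℝ) (r : Y → ℝ) :
    ∑ x, q x * relEntropy (W x) r
      = ∑ x, q x * relEntropy (W x) (outputDist W q) + relEntropy (outputDist W q) r := by
  rw [sum_mul_relEntropy_eq, sum_mul_relEntropy_eq, relEntropy_eq, entropy]
  ring

theorem sum_outputDist (hW : IsChannel W) (q : X → ℝ) : ∑ y, outputDist W q y = ∑ x, q x := by
  simp_rw [outputDist]
  rw [Finset.sum_comm]
  exact Finset.sum_congr rfl fun x _ => by rw [← Finset.sum_mul, (hW x).2, one_mul]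

theorem outputDist_mem_stdSimplex (hW : IsChannel W) {q : X → ℝ} (hq : q ∈ stdSimplex ℝ X) :
    outputDist W q ∈ stdSimplex ℝ Y := by
  exact ⟨fun y => Finset.sum_nonneg fun x _ => mul_nonneg ((hW x).1 y) (hq.1 x),
    (sum_outputDist hW q).trans hq.2⟩

theorem outputDist_eq_zero (hW : IsChannel W) {q : X → ℝ} (hq : ∀ x, x ∉ S → q x = 0) {y : Y}
    (hy : y ∉ outputs W S) : outputDist W q y = 0 := by
  refine Finset.sum_eq_zero fun x _ => ?_
  by_cases hx : x ∈ S
  · rw [eq_zero_of_notMem_outputs hW hx hy, zero_mul]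
  · rw [hq x hx, mul_zero]

theorem outputDist_injective {X Y : Type*} [Fintype X] {W : X → Y → ℝ}
    (hli : LinearIndependent ℝ W) :
    Function.Injective (outputDist W) := by
  intro q q' h
  ext x
  refine sub_eq_zero.mp (Fintype.linearIndependent_iff.mp hli (fun x => q x - q' x) ?_ x)
  ext y
  have hy := congrFun h y
  simp only [outputDist] at hy
  simp only [Finset.sum_apply, Pi.smul_apply, smul_eq_mul, Pi.zero_apply, mul_comm _ (W _ _),
    mul_sub, Finset.sum_sub_distrib]
  rw [hy, sub_self]

theorem mutualInfo_eq_sum (hW : IsChannel W) {q : X → ℝ} (hq : q ∈ stdSimplex ℝ X) :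
    mutualInfo W q = ∑ x, q x * relEntropy (W x) (outputDist W q) := by
  simp only [mutualInfo, relEntropy, Fintype.sum_prod_type, Finset.mul_sum]
  refine Finset.sum_congr rfl fun x _ => Finset.sum_congr rfl fun y _ => ?_
  by_cases h1 : q x = 0
  · simp [h1]
  by_cases h2 : W x y = 0
  · simp [h2]
  have hpos : 0 < W x y * q x :=
    mul_pos (((hW x).1 y).lt_of_ne' h2) ((hq.1 x).lt_of_ne' h1)
  have h3 : outputDist W q y ≠ 0 := by
    refine (hpos.trans_le ?_).ne'
    exact Finset.single_le_sum (f := fun x => W x y * q x)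
      (fun x _ => mul_nonneg ((hW x).1 y) (hq.1 x)) (Finset.mem_univ x)
  rw [Real.log_mul h2 h1, Real.log_mul h3 h1]
  ring

/-- A strictly concave function of the output minus a linear function of `q`: this form shows
continuity, and uniqueness of the optimum because `outputDist` is injective. -/
theorem mutualInfo_eq_entropy_sub (hW : IsChannel W) {q : X → ℝ} (hq : q ∈ stdSimplex ℝ X) :
    mutualInfo W q = ∑ y, Real.negMulLog (outputDist W q y) - ∑ x, q x * entropy (W x) := by
  rw [mutualInfo_eq_sum hW hq, sum_mul_relEntropy_eq, ← entropy_eq_sum_negMulLog, entropy]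
  ring

theorem mutualInfo_single [DecidableEq X] (hW : IsChannel W) (x : X) :
    mutualInfo W (Pi.single x 1) = 0 := by
  have h : outputDist W (Pi.single x 1) = W x := by
    ext y
    simp [outputDist, Pi.single_apply]
  rw [mutualInfo_eq_sum hW (single_mem_stdSimplex ℝ x), h]
  simp [Pi.single_apply, relEntropy]

theorem mutualInfo_nonneg (hW : IsChannel W) {q : X → ℝ} (hq : q ∈ stdSimplex ℝ X) :
    0 ≤ mutualInfo W q := by
  rw [mutualInfo_eq_sum hW hq]
  refine Finset.sum_nonneg fun x _ => ?_
  by_cases h1 : q x = 0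
  · simp [h1]
  refine mul_nonneg (hq.1 x) (relEntropy_nonneg (hW x) (outputDist_mem_stdSimplex hW hq) ?_)
  intro y hy
  have := (Finset.sum_eq_zero_iff_of_nonneg
    fun x _ => mul_nonneg ((hW x).1 y) (hq.1 x)).mp hy x (Finset.mem_univ x)
  exact (mul_eq_zero.mp this).resolve_right h1

theorem isOptimalInput_unique (hW : IsChannel W) (hli : LinearIndependent ℝ W) {q q' : X → ℝ}
    (hq : IsOptimalInput W S q) (hq' : IsOptimalInput W S q') : q = q' := by
  by_contra hne
  have hout : outputDist W q ≠ outputDist W q' := fun h => hne (outputDist_injective hli h)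
  obtain ⟨y₀, hy₀⟩ := Function.ne_iff.mp hout
  set m : X → ℝ := fun x => (1 / 2 : ℝ) * q x + (1 / 2 : ℝ) * q' x with hm
  have hmS : m ∈ inputsOn S := by
    refine ⟨convex_stdSimplex ℝ X hq.1.1 hq'.1.1 (by norm_num : (0 : ℝ) ≤ 1 / 2)
      (by norm_num : (0 : ℝ) ≤ 1 / 2) (by norm_num), fun x hx => ?_⟩
    simp [hm, hq.1.2 x hx, hq'.1.2 x hx]
  have hmo : ∀ y, outputDist W m y
      = (1 / 2 : ℝ) * outputDist W q y + (1 / 2 : ℝ) * outputDist W q' y := by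
    intro y
    simp only [outputDist, hm, Finset.mul_sum, ← Finset.sum_add_distrib]
    exact Finset.sum_congr rfl fun x _ => by ring
  have h0 := fun y => (outputDist_mem_stdSimplex hW hq.1.1).1 y
  have h0' := fun y => (outputDist_mem_stdSimplex hW hq'.1.1).1 y
  have hlt : ∑ y, ((1 / 2 : ℝ) * Real.negMulLog (outputDist W q y)
        + (1 / 2 : ℝ) * Real.negMulLog (outputDist W q' y))
      < ∑ y, Real.negMulLog (outputDist W m y) := by
    simp_rw [hmo]
    refine Finset.sum_lt_sum (fun y _ => ?_) ⟨y₀, Finset.mem_univ _, ?_⟩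
    · exact Real.concaveOn_negMulLog.2 (h0 y) (h0' y) (by norm_num) (by norm_num) (by norm_num)
    · exact Real.strictConcaveOn_negMulLog.2 (h0 y₀) (h0' y₀) hy₀ (by norm_num) (by norm_num)
        (by norm_num)
  have hlin : ∑ x, m x * entropy (W x)
      = (1 / 2 : ℝ) * ∑ x, q x * entropy (W x) + (1 / 2 : ℝ) * ∑ x, q' x * entropy (W x) := by
    simp only [hm, Finset.mul_sum, ← Finset.sum_add_distrib]
    exact Finset.sum_congr rfl fun x _ => by ring
  rw [Finset.sum_add_distrib, ← Finset.mul_sum, ← Finset.mul_sum] at hlt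
  have h1 := isMaxOn_iff.mp hq.2 _ hmS
  have h2 := isMaxOn_iff.mp hq'.2 _ hmS
  rw [mutualInfo_eq_entropy_sub hW hmS.1, mutualInfo_eq_entropy_sub hW hq.1.1, hlin] at h1
  rw [mutualInfo_eq_entropy_sub hW hmS.1, mutualInfo_eq_entropy_sub hW hq'.1.1, hlin] at h2
  linarith

theorem single_mem_inputsOn [DecidableEq X] {x : X} (hx : x ∈ S) :
    (Pi.single x 1 : X → ℝ) ∈ inputsOn S :=
  ⟨single_mem_stdSimplex ℝ x, fun z hz => by
    rw [Pi.single_eq_of_ne]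
    rintro rfl
    exact hz hx⟩

theorem exists_isOptimalInput (hW : IsChannel W) (hS : S.Nonempty) :
    ∃ q, IsOptimalInput W S q := by
  classical
  obtain ⟨x, hx⟩ := hS
  have hcl : IsClosed (inputsOn S) := by
    have : inputsOn S = stdSimplex ℝ X ∩ ⋂ x ∈ Sᶜ, {q : X → ℝ | q x = 0} := by
      ext q
      simp [inputsOn]
    rw [this]
    exact (isClosed_stdSimplex ℝ X).inter <| isClosed_biInter fun x _ =>
      isClosed_eq (continuous_apply x) continuous_const
  have hcpt : IsCompact (inputsOn S) :=
    (isCompact_stdSimplex ℝ X).of_isClosed_subset hcl fun q hq => hq.1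
  have hcont : ContinuousOn (mutualInfo W) (inputsOn S) := by
    have hc : Continuous fun q : X → ℝ =>
        ∑ y, Real.negMulLog (outputDist W q y) - ∑ x, q x * entropy (W x) := by
      unfold outputDist
      fun_prop
    exact hc.continuousOn.congr fun q hq => mutualInfo_eq_entropy_sub hW hq.1
  obtain ⟨q, hq, hmax⟩ := hcpt.exists_isMaxOn ⟨_, single_mem_inputsOn hx⟩ hcont
  exact ⟨q, hq, hmax⟩

theorem IsOptimalInput.capacity_eq {q : X → ℝ} (hq : IsOptimalInput W S q) :
    capacity W S = mutualInfo W q :=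
  IsGreatest.csSup_eq ⟨⟨q, hq.1, rfl⟩, by
    rintro _ ⟨q', hq', rfl⟩
    exact isMaxOn_iff.mp hq.2 q' hq'⟩

end Divergence

/-! ### Kuhn–Tucker conditions and signed equalizing inputs. -/

section Optimality

variable {X Y : Type*} [Fintype X] [Fintype Y] {W : X → Y → ℝ} {S : Set X}

/-- Moving an optimal input distribution towards a single input. -/
theorem IsOptimalInput.relEntropy_mix_le (hW : IsChannel W) {q : X → ℝ}
    (hq : IsOptimalInput W S q) {x : X} (hx : x ∈ S) {t : ℝ} (ht0 : 0 < t) (ht1 : t < 1) :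
    relEntropy (W x) (fun y => (1 - t) * outputDist W q y + t * W x y) ≤ mutualInfo W q := by
  classical
  set Q : Y → ℝ := fun y => (1 - t) * outputDist W q y + t * W x y with hQ
  let p : X → ℝ := fun z => (1 - t) * q z + t * (Pi.single x 1 : X → ℝ) z
  have hxS := single_mem_inputsOn (S := S) hx
  have hp : p ∈ inputsOn S := by
    refine ⟨convex_stdSimplex ℝ X hq.1.1 hxS.1 (by linarith) ht0.le (by ring), fun z hz => ?_⟩
    simp only [p]
    rw [hq.1.2 z hz, hxS.2 z hz, mul_zero, mul_zero, add_zero]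
  have hpQ : outputDist W p = Q := by
    ext y
    have h1 : ∑ z, W z y * (Pi.single x 1 : X → ℝ) z = W x y := by simp [Pi.single_apply]
    calc outputDist W p y
        = (1 - t) * ∑ z, W z y * q z + t * ∑ z, W z y * (Pi.single x 1 : X → ℝ) z := by
          simp only [outputDist, p, Finset.mul_sum, ← Finset.sum_add_distrib]
          exact Finset.sum_congr rfl fun z _ => by ring
      _ = Q y := by rw [h1]; rfl
  have hQs : Q ∈ stdSimplex ℝ Y := hpQ ▸ outputDist_mem_stdSimplex hW hp.1
  have hqo := outputDist_mem_stdSimplex hW hq.1.1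
  have hnn : 0 ≤ relEntropy (outputDist W q) Q := by
    refine relEntropy_nonneg hqo hQs fun y hy => ?_
    have h1 : 0 ≤ (1 - t) * outputDist W q y := mul_nonneg (by linarith) (hqo.1 y)
    have h2 : 0 ≤ t * W x y := mul_nonneg ht0.le ((hW x).1 y)
    have h3 : (1 - t) * outputDist W q y = 0 := by
      simp only [hQ] at hy
      linarith
    exact (mul_eq_zero.mp h3).resolve_left (by linarith)
  -- The compensation identity for `q` with reference `Q`. Comparing with `I(p) ≤ I(q)`, one drops
  -- the nonnegative divergence and divides by `t`.
  have hmi : mutualInfo W p = (1 - t) * (mutualInfo W q + relEntropy (outputDist W q) Q)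
      + t * relEntropy (W x) Q := by
    have h1 : ∑ z, (Pi.single x 1 : X → ℝ) z * relEntropy (W z) Q = relEntropy (W x) Q := by
      simp [Pi.single_apply]
    rw [mutualInfo_eq_sum hW hp.1, hpQ, mutualInfo_eq_sum hW hq.1.1, ← sum_mul_relEntropy, ← h1]
    simp only [p, Finset.mul_sum, ← Finset.sum_add_distrib]
    exact Finset.sum_congr rfl fun z _ => by ring
  have hle := isMaxOn_iff.mp hq.2 p hp
  rw [hmi] at hle
  have h4 : 0 ≤ (1 - t) * relEntropy (outputDist W q) Q := mul_nonneg (by linarith) hnn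
  refine le_of_mul_le_mul_left ?_ ht0
  linarith

/-- If `y` had probability zero, mixing in a weight `t` of an input reaching `y` would give a
divergence of order `W x y * (-log t)`, beyond the bound of `relEntropy_mix_le` for small `t`. -/
theorem IsOptimalInput.outputDist_pos (hW : IsChannel W) {q : X → ℝ}
    (hq : IsOptimalInput W S q) {y : Y} (hy : y ∈ outputs W S) : 0 < outputDist W q y := by
  have hqo := outputDist_mem_stdSimplex hW hq.1.1
  refine (hqo.1 y).lt_of_ne' fun h0 => ?_
  obtain ⟨x, hx, hpos⟩ := mem_outputs.mp hy
  set M := mutualInfo W q + entropy (W x) with hM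
  -- Chosen so that `W x y * K = |M| + W x y` exceeds `M`; the weight is `t = exp (-K)`.
  set K := |M| / W x y + 1 with hK
  have hKpos : 0 < K := by positivity
  have ht1 : Real.exp (-K) < 1 := Real.exp_lt_one_iff.mpr (by linarith)
  set t := Real.exp (-K) with ht
  have ht0 : 0 < t := Real.exp_pos _
  have hle := hq.relEntropy_mix_le hW hx ht0 ht1
  have hQs : (fun y => (1 - t) * outputDist W q y + t * W x y) ∈ stdSimplex ℝ Y :=
    convex_stdSimplex ℝ Y hqo (hW x) (by linarith) ht0.le (by ring)
  rw [relEntropy_eq] at hle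
  have hW1 : ∀ z, W x z ≤ 1 := fun z => by
    rw [← (hW x).2]
    exact Finset.single_le_sum (fun z _ => (hW x).1 z) (Finset.mem_univ z)
  have hsum : ∑ z, W x z * Real.log ((1 - t) * outputDist W q z + t * W x z)
      ≤ W x y * Real.log ((1 - t) * outputDist W q y + t * W x y) := by
    classical
    rw [← Finset.add_sum_erase _ _ (Finset.mem_univ y)]
    refine add_le_of_nonpos_right (Finset.sum_nonpos fun z _ => ?_)
    refine mul_nonpos_of_nonneg_of_nonpos ((hW x).1 z) (Real.log_nonpos (hQs.1 z) ?_)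
    exact (Finset.single_le_sum (fun z _ => hQs.1 z) (Finset.mem_univ z)).trans_eq hQs.2
  have hlog : Real.log ((1 - t) * outputDist W q y + t * W x y) ≤ -K := by
    rw [h0, mul_zero, zero_add, Real.log_mul ht0.ne' hpos.ne', ht, Real.log_exp]
    linarith [Real.log_nonpos hpos.le (hW1 y)]
  have h1 := mul_le_mul_of_nonneg_left hlog hpos.le
  have h2 : W x y * K = |M| + W x y := by
    rw [hK]
    field_simp
  have h3 := le_abs_self M
  linarith

/-- Let `t → 0` in `relEntropy_mix_le`; `outputDist_pos` makes the logarithms continuous where `W x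
y ≠ 0`. -/
theorem IsOptimalInput.relEntropy_le (hW : IsChannel W) {q : X → ℝ}
    (hq : IsOptimalInput W S q) {x : X} (hx : x ∈ S) :
    relEntropy (W x) (outputDist W q) ≤ mutualInfo W q := by
  have hlim : Filter.Tendsto
      (fun t : ℝ => relEntropy (W x) (fun y => (1 - t) * outputDist W q y + t * W x y))
      (nhdsWithin 0 (Set.Ioi 0)) (nhds (relEntropy (W x) (outputDist W q))) := by
    refine Filter.Tendsto.mono_left ?_ nhdsWithin_le_nhds
    refine tendsto_finsetSum _ fun y _ => ?_
    by_cases hxy : W x y = 0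
    · simp [hxy]
    have hpos := hq.outputDist_pos hW (mem_outputs.mpr ⟨x, hx, ((hW x).1 y).lt_of_ne' hxy⟩)
    have hc : Filter.Tendsto (fun t : ℝ => (1 - t) * outputDist W q y + t * W x y) (nhds 0)
        (nhds (outputDist W q y)) := by
      have h : Continuous fun t : ℝ => (1 - t) * outputDist W q y + t * W x y := by fun_prop
      simpa using h.tendsto 0
    exact ((hc.log hpos.ne').const_sub _).const_mul _
  refine le_of_tendsto hlim ?_
  filter_upwards [Ioo_mem_nhdsGT (zero_lt_one' ℝ)] with t ht
  exact hq.relEntropy_mix_le hW hx ht.1 ht.2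

/-- The `q`-average of the divergences is `I(q)`, which also bounds each of them on `S`. -/
theorem IsOptimalInput.relEntropy_eq_of_ne_zero (hW : IsChannel W) {q : X → ℝ}
    (hq : IsOptimalInput W S q) {x : X} (hx : q x ≠ 0) :
    relEntropy (W x) (outputDist W q) = mutualInfo W q := by
  have hle : ∀ z, q z * relEntropy (W z) (outputDist W q) ≤ q z * mutualInfo W q := by
    intro z
    by_cases hz : z ∈ S
    · exact mul_le_mul_of_nonneg_left (hq.relEntropy_le hW hz) (hq.1.1.1 z)
    · rw [hq.1.2 z hz, zero_mul, zero_mul]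
  have hsum : ∑ z, q z * relEntropy (W z) (outputDist W q) = ∑ z, q z * mutualInfo W q := by
    rw [← Finset.sum_mul, hq.1.1.2, one_mul, mutualInfo_eq_sum hW hq.1.1]
  exact mul_left_cancel₀ hx
    ((Finset.sum_eq_sum_iff_of_le fun z _ => hle z).mp hsum x (Finset.mem_univ x))

/-- `v` is a real function on `S` of total mass one whose output `W · v` is a distribution
positive on the output alphabet of `S` and has divergence `d` from every input in `S`. -/
structure IsEqualizer (W : X → Y → ℝ) (S : Set X) (d : ℝ) (v : X → ℝ) : Prop where
  eq_zero : ∀ x, x ∉ S → v x = 0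
  sum_eq_one : ∑ x, v x = 1
  pos : ∀ y ∈ outputs W S, 0 < outputDist W v y
  relEntropy_eq : ∀ x ∈ S, relEntropy (W x) (outputDist W v) = d

namespace IsEqualizer

variable {d : ℝ} {v q : X → ℝ}

theorem outputDist_mem (hW : IsChannel W) (hv : IsEqualizer W S d v) :
    outputDist W v ∈ stdSimplex ℝ Y := by
  refine ⟨fun y => ?_, by rw [sum_outputDist hW, hv.sum_eq_one]⟩
  by_cases hy : y ∈ outputs W S
  · exact (hv.pos y hy).le
  · rw [outputDist_eq_zero hW hv.eq_zero hy]

theorem sum_mul_relEntropy_eq (hv : IsEqualizer W S d v) {p : X → ℝ}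
    (hp : ∀ x, x ∉ S → p x = 0) (hp1 : ∑ x, p x = 1) :
    ∑ x, p x * relEntropy (W x) (outputDist W v) = d := by
  rw [← one_mul d, ← hp1, Finset.sum_mul]
  refine Finset.sum_congr rfl fun x _ => ?_
  by_cases hx : x ∈ S
  · rw [hv.relEntropy_eq x hx]
  · rw [hp x hx, zero_mul, zero_mul]

theorem mutualInfo_eq (hW : IsChannel W) (hv : IsEqualizer W S d v) (hq : q ∈ inputsOn S) :
    mutualInfo W q = d - relEntropy (outputDist W q) (outputDist W v) := by
  rw [mutualInfo_eq_sum hW hq.1, ← hv.sum_mul_relEntropy_eq hq.2 hq.1.2,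
    sum_mul_relEntropy q (outputDist W v)]
  ring

theorem outputDist_eq_zero_of (hW : IsChannel W) (hv : IsEqualizer W S d v)
    (hq : ∀ x, x ∉ S → q x = 0) (y : Y) (hy : outputDist W v y = 0) : outputDist W q y = 0 :=
  outputDist_eq_zero hW hq fun h => (hv.pos y h).ne' hy

theorem mutualInfo_le (hW : IsChannel W) (hv : IsEqualizer W S d v) (hq : q ∈ inputsOn S) :
    mutualInfo W q ≤ d := by
  rw [hv.mutualInfo_eq hW hq]
  linarith [relEntropy_nonneg (outputDist_mem_stdSimplex hW hq.1) (hv.outputDist_mem hW)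
    (hv.outputDist_eq_zero_of hW hq.2)]

theorem eq_of_le_mutualInfo (hW : IsChannel W) (hli : LinearIndependent ℝ W)
    (hv : IsEqualizer W S d v) (hq : q ∈ inputsOn S) (hle : d ≤ mutualInfo W q) : q = v := by
  rw [hv.mutualInfo_eq hW hq] at hle
  exact outputDist_injective hli <|
    eq_of_relEntropy_le_zero (outputDist_mem_stdSimplex hW hq.1) (hv.outputDist_mem hW)
      (hv.outputDist_eq_zero_of hW hq.2) (by linarith)

theorem isOptimalInput_of_nonneg (hW : IsChannel W) (hv : IsEqualizer W S d v)
    (h0 : ∀ x, 0 ≤ v x) : IsOptimalInput W S v ∧ mutualInfo W v = d := by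
  have hvS : v ∈ inputsOn S := ⟨⟨h0, hv.sum_eq_one⟩, hv.eq_zero⟩
  have hd : mutualInfo W v = d := by
    rw [hv.mutualInfo_eq hW hvS]
    simp [relEntropy]
  refine ⟨⟨hvS, fun q hq => ?_⟩, hd⟩
  change mutualInfo W q ≤ mutualInfo W v
  rw [hd]
  exact hv.mutualInfo_le hW hq

/-- If `v` is nonnegative off the support of the optimal input, then it is the optimal input. -/
theorem eq_of_isOptimalInput (hW : IsChannel W) (hli : LinearIndependent ℝ W)
    (hv : IsEqualizer W S d v) (hq : IsOptimalInput W S q)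
    (h : ∀ x ∈ S, q x = 0 → 0 ≤ v x) : q = v := by
  refine hv.eq_of_le_mutualInfo hW hli hq.1 ?_
  have hnn : 0 ≤ relEntropy (outputDist W v) (outputDist W q) :=
    relEntropy_nonneg (hv.outputDist_mem hW) (outputDist_mem_stdSimplex hW hq.1.1) fun y hy =>
      outputDist_eq_zero hW hv.eq_zero fun hy' => (hq.outputDist_pos hW hy').ne' hy
  -- The compensation identity needs no positivity, so the signed weights `v` are allowed.
  have hsum := sum_mul_relEntropy (W := W) v (outputDist W q)
  rw [hv.sum_mul_relEntropy_eq hv.eq_zero hv.sum_eq_one] at hsum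
  -- On the support of `q` equality holds whatever the sign of `v x`; off it, `v x` is nonnegative.
  have hle : ∑ x, v x * relEntropy (W x) (outputDist W q) ≤ ∑ x, v x * mutualInfo W q := by
    refine Finset.sum_le_sum fun x _ => ?_
    by_cases hx : x ∈ S
    · by_cases hqx : q x = 0
      · exact mul_le_mul_of_nonneg_left (hq.relEntropy_le hW hx) (h x hx hqx)
      · rw [hq.relEntropy_eq_of_ne_zero hW hqx]
    · rw [hv.eq_zero x hx, zero_mul, zero_mul]
  rw [← Finset.sum_mul, hv.sum_eq_one, one_mul] at hle
  linarith

end IsEqualizer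

theorem OutputCoordinates.isEqualizer (c : OutputCoordinates W S) (hW : IsChannel W)
    (hli : LinearIndependent ℝ W) : IsEqualizer W S c.value c.solution := by
  obtain ⟨h0, h1, hP⟩ := c.isSolution_solution hW hli
  have hPo : outputDist W c.solution = c.expDist c.minimizer := by
    ext y
    rw [← hP y]
    exact Finset.sum_congr rfl fun x _ => mul_comm _ _
  refine ⟨h0, h1, fun y hy => ?_, fun x hx => ?_⟩
  · rw [hPo, c.expDist_of_mem hy]
    exact Real.exp_pos _
  · rw [hPo]
    exact c.relEntropy_expDist hW hli hx

end Optimality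

/-! ### Comparison of `Ĉ(S)` with the capacity. -/

section Candidates

variable {X Y : Type*} [Fintype X] [Fintype Y] {W : X → Y → ℝ} {κ : CoordinateChoice W}
  {S : Set X} {q : X → ℝ}

theorem isEqualizer_unconstrained (hW : IsChannel W) (hli : LinearIndependent ℝ W)
    (hS : S.Nonempty) : IsEqualizer W S (cHat κ S) (unconstrained κ S) := by
  simpa only [cHat, unconstrained, hS, dite_true] using (κ S hS).isEqualizer hW hli

theorem unconstrained_nonneg (hW : IsChannel W) (hli : LinearIndependent ℝ W)
    (hS : S.Nonempty) (hN : negSet κ S = ∅) (x : X) : 0 ≤ unconstrained κ S x := by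
  by_cases hx : x ∈ S
  · exact not_lt.mp fun h => Set.notMem_empty x (hN ▸ ⟨hx, h⟩)
  · rw [(isEqualizer_unconstrained hW hli hS).eq_zero x hx]

theorem isOptimalInput_unconstrained (hW : IsChannel W) (hli : LinearIndependent ℝ W)
    (hS : S.Nonempty) (hN : negSet κ S = ∅) :
    IsOptimalInput W S (unconstrained κ S) ∧ mutualInfo W (unconstrained κ S) = cHat κ S :=
  (isEqualizer_unconstrained hW hli hS).isOptimalInput_of_nonneg hW
    (unconstrained_nonneg hW hli hS hN)

theorem cHat_eq_capacity (hW : IsChannel W) (hli : LinearIndependent ℝ W) (hS : S.Nonempty)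
    (hN : negSet κ S = ∅) : cHat κ S = capacity W S := by
  obtain ⟨h1, h2⟩ := isOptimalInput_unconstrained hW hli hS hN
  rw [h1.capacity_eq, h2]

theorem exists_mem_negSet_notMem_support (hW : IsChannel W) (hli : LinearIndependent ℝ W)
    (hN : (negSet κ S).Nonempty) (hq : IsOptimalInput W S q) :
    ((S \ Function.support q) ∩ negSet κ S).Nonempty := by
  by_contra hemp
  obtain ⟨x, hxS, hx⟩ := hN
  have heq := (isEqualizer_unconstrained hW hli ⟨x, hxS⟩).eq_of_isOptimalInput hW hli hq
    fun z hz hqz => not_lt.mp fun hlt => hemp ⟨z, ⟨hz, by simpa using hqz⟩, hz, hlt⟩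
  exact (hq.1.1.1 x).not_gt (heq ▸ hx)

theorem mem_inputsOn_of_support_subset (hq : q ∈ stdSimplex ℝ X)
    (hS : Function.support q ⊆ S) : q ∈ inputsOn S :=
  ⟨hq, fun _ hx => Function.notMem_support.mp fun h => hx (hS h)⟩

theorem nonempty_of_mem_inputsOn (hq : q ∈ inputsOn S) : S.Nonempty := by
  by_contra h
  rw [Set.not_nonempty_iff_eq_empty] at h
  have h1 := hq.1.2
  rw [Finset.sum_eq_zero fun x _ => hq.2 x (by simp [h])] at h1
  exact zero_ne_one h1

theorem isOptimalInput_of_support_subset (hq : IsOptimalInput W Set.univ q)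
    (hS : Function.support q ⊆ S) : IsOptimalInput W S q :=
  ⟨mem_inputsOn_of_support_subset hq.1.1 hS,
    hq.2.on_subset fun _ hp => ⟨hp.1, fun _ hx => absurd (Set.mem_univ _) hx⟩⟩

/-- Equality would force `q` to be the unconstrained solution, which has a negative value. This
strictness is what the pruning test needs. -/
theorem mutualInfo_lt_cHat (hW : IsChannel W) (hli : LinearIndependent ℝ W)
    (hq : q ∈ inputsOn S) (hN : (negSet κ S).Nonempty) : mutualInfo W q < cHat κ S := by
  by_contra hle
  obtain ⟨x, hxS, hx⟩ := hN
  have heq := (isEqualizer_unconstrained hW hli ⟨x, hxS⟩).eq_of_le_mutualInfo hW hli hq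
    (not_lt.mp hle)
  exact (hq.1.1 x).not_gt (heq ▸ hx)

theorem cHat_le_mutualInfo (hW : IsChannel W) (hli : LinearIndependent ℝ W)
    (hq : IsOptimalInput W Set.univ q) (hN : negSet κ S = ∅) : cHat κ S ≤ mutualInfo W q := by
  by_cases hS : S.Nonempty
  · obtain ⟨h1, h2⟩ := isOptimalInput_unconstrained hW hli hS hN
    rw [← h2]
    exact isMaxOn_iff.mp hq.2 _ ⟨h1.1.1, fun _ hx => absurd (Set.mem_univ _) hx⟩
  · rw [cHat, dif_neg hS]
    exact mutualInfo_nonneg hW hq.1.1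

theorem mutualInfo_le_cHat (hW : IsChannel W) (hli : LinearIndependent ℝ W)
    (hq : q ∈ inputsOn S) : mutualInfo W q ≤ cHat κ S :=
  (isEqualizer_unconstrained hW hli (nonempty_of_mem_inputsOn hq)).mutualInfo_le hW hq

/-- Excludes the empty set, of conventional value `0`, as a maximizer. At zero capacity every point
mass is optimal, so by uniqueness `X` has one element and the unconstrained solution is `1` there.
-/
theorem mutualInfo_pos (hW : IsChannel W) (hli : LinearIndependent ℝ W)
    (hN : (negSet κ Set.univ).Nonempty) (hq : IsOptimalInput W Set.univ q) :
    0 < mutualInfo W q := by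
  classical
  by_contra hle
  obtain ⟨x, -, hx⟩ := hN
  have hopt : ∀ z, IsOptimalInput W Set.univ (Pi.single z 1 : X → ℝ) := by
    intro z
    refine ⟨single_mem_inputsOn (Set.mem_univ z), fun p hp => ?_⟩
    change mutualInfo W p ≤ mutualInfo W _
    rw [mutualInfo_single hW]
    exact (isMaxOn_iff.mp hq.2 p hp).trans (not_lt.mp hle)
  have hsub : ∀ z, z = x := by
    intro z
    by_contra hne
    have h := congrFun (isOptimalInput_unique hW hli (hopt z) (hopt x)) z
    rw [Pi.single_eq_same, Pi.single_eq_of_ne hne] at h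
    exact one_ne_zero h
  have hsum := (isEqualizer_unconstrained (κ := κ) hW hli ⟨x, Set.mem_univ x⟩).sum_eq_one
  rw [Fintype.sum_eq_single x fun z hz => absurd (hsub z) hz] at hsum
  linarith

theorem eq_unconstrained (hW : IsChannel W) (hli : LinearIndependent ℝ W)
    (hq : IsOptimalInput W Set.univ q) (hpos : 0 < mutualInfo W q) (hN : negSet κ S = ∅)
    (hle : mutualInfo W q ≤ cHat κ S) : q = unconstrained κ S := by
  have hS : S.Nonempty := by
    by_contra hS
    rw [cHat, dif_neg hS] at hle
    exact hpos.not_ge hle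
  obtain ⟨h1, h2⟩ := isOptimalInput_unconstrained hW hli hS hN
  refine isOptimalInput_unique hW hli hq
    ⟨⟨h1.1.1, fun _ hx => absurd (Set.mem_univ _) hx⟩, fun p hp => ?_⟩
  change mutualInfo W p ≤ mutualInfo W _
  rw [h2]
  exact (isMaxOn_iff.mp hq.2 p hp).trans hle

end Candidates

/-! ### Invariant, termination and output of the algorithm. -/

section Rounds

variable {X Y : Type*} [Fintype X] [Fintype Y] {W : X → Y → ℝ} {κ : CoordinateChoice W}
  {q : X → ℝ}

theorem negSet_compl_eq_empty_of_mem_newB {A : Set (Set X)} {Z : Set X} (hZ : Z ∈ newB κ A) :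
    negSet κ Zᶜ = ∅ := by
  obtain ⟨_, _, _, _, h, rfl⟩ := hZ
  exact h

theorem negSet_compl_eq_empty_of_mem_familyB {j : ℕ} {Z : Set X} (hZ : Z ∈ familyB κ j) :
    negSet κ Zᶜ = ∅ := by
  induction j with
  | zero => exact absurd hZ (Set.notMem_empty Z)
  | succ j ih =>
    cases j with
    | zero => exact negSet_compl_eq_empty_of_mem_newB hZ
    | succ j =>
      rcases hZ with hZ | hZ
      · exact ih hZ
      · exact negSet_compl_eq_empty_of_mem_newB hZ

theorem ncard_of_mem_familyA {j : ℕ} {Z : Set X} (hZ : Z ∈ familyA κ (j + 1)) :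
    Z.ncard = j + 1 := by
  induction j generalizing Z with
  | zero =>
    obtain ⟨x, -, rfl⟩ := hZ
    exact Set.ncard_singleton x
  | succ j ih =>
    obtain ⟨X₁, hX₁, x, hx, -, -, rfl⟩ := hZ
    rw [Set.ncard_insert_of_notMem hx.1 (Set.toFinite X₁), ih hX₁]

theorem familyA_eq_empty_of_card_lt {j : ℕ} (hj : Fintype.card X < j + 1) :
    familyA κ (j + 1) = ∅ := by
  rw [Set.eq_empty_iff_forall_notMem]
  intro Z hZ
  have h1 := ncard_of_mem_familyA hZ
  have h2 := Set.ncard_le_card Z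
  rw [Nat.card_eq_fintype_card] at h2
  omega

theorem maxOver_familyB_le (hW : IsChannel W) (hli : LinearIndependent ℝ W)
    (hq : IsOptimalInput W Set.univ q) (j : ℕ) :
    maxOver κ (familyB κ j) ≤ ((mutualInfo W q : ℝ) : EReal) :=
  iSup₂_le fun _ hZ => EReal.coe_le_coe_iff.mpr <|
    cHat_le_mutualInfo hW hli hq (negSet_compl_eq_empty_of_mem_familyB hZ)

/-- In every round, a set avoiding the support of the optimal input distribution is either
among the final candidates or among those to be enlarged. -/
theorem exists_mem_familyB_or_familyA (hW : IsChannel W) (hli : LinearIndependent ℝ W)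
    (hN : (negSet κ Set.univ).Nonempty) (hq : IsOptimalInput W Set.univ q) (j : ℕ) :
    (∃ Z ∈ familyB κ (j + 1), Function.support q ⊆ Zᶜ) ∨
      ∃ Z ∈ familyA κ (j + 1), Function.support q ⊆ Zᶜ ∧ (negSet κ Zᶜ).Nonempty := by
  -- The clause `(negSet κ Zᶜ).Nonempty` supplies the next input to remove; membership in `familyA κ
  -- 1` alone does not imply it.
  induction j with
  | zero =>
    obtain ⟨x, ⟨-, hxq⟩, hxN⟩ := exists_mem_negSet_notMem_support hW hli hN hq
    have hsub : Function.support q ⊆ ({x} : Set X)ᶜ := by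
      rwa [Set.subset_compl_singleton_iff]
    rcases (negSet κ ({x} : Set X)ᶜ).eq_empty_or_nonempty with he | hne
    · refine Or.inl ⟨{x}, ⟨∅, rfl, x, Set.notMem_empty x, ?_, ?_⟩, hsub⟩
      · rwa [insert_empty_eq]
      · rw [insert_empty_eq]
    · exact Or.inr ⟨{x}, ⟨x, hxN, rfl⟩, hsub, hne⟩
  | succ j ih =>
    rcases ih with ⟨Z, hZ, hsub⟩ | ⟨Z, hZ, hsub, hne⟩
    · exact Or.inl ⟨Z, Or.inl hZ, hsub⟩
    · obtain ⟨x, ⟨-, hxq⟩, hxN⟩ := exists_mem_negSet_notMem_support hW hli hne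
        (isOptimalInput_of_support_subset hq hsub)
      have hsub' : Function.support q ⊆ (insert x Z)ᶜ := by
        rintro z hz (rfl | hzZ)
        · exact hxq hz
        · exact hsub hz hzZ
      rcases (negSet κ (insert x Z)ᶜ).eq_empty_or_nonempty with he | hne'
      · exact Or.inl ⟨_, Or.inr ⟨Z, hZ, x, hxN.1, he, rfl⟩, hsub'⟩
      · refine Or.inr ⟨_, ⟨Z, hZ, x, hxN, hne', ?_, rfl⟩, hsub', hne'⟩
        -- The pruning test passes: the current maximum is at most the capacity, which lies strictly
        -- below the value of the enlarged candidate.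
        exact (maxOver_familyB_le hW hli hq (j + 1)).trans_lt <| EReal.coe_lt_coe_iff.mpr <|
          mutualInfo_lt_cHat hW hli (mem_inputsOn_of_support_subset hq.1.1 hsub') hne'

theorem exists_mem_familyB (hW : IsChannel W) (hli : LinearIndependent ℝ W)
    (hN : (negSet κ Set.univ).Nonempty) (hq : IsOptimalInput W Set.univ q) {j : ℕ}
    (hA : familyA κ (j + 1) = ∅) : ∃ Z ∈ familyB κ (j + 1), Function.support q ⊆ Zᶜ := by
  rcases exists_mem_familyB_or_familyA hW hli hN hq j with h | ⟨Z, hZ, -⟩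
  · exact h
  · exact absurd hZ (hA ▸ Set.notMem_empty Z)

theorem maxOver_familyB_eq (hW : IsChannel W) (hli : LinearIndependent ℝ W)
    (hN : (negSet κ Set.univ).Nonempty) (hq : IsOptimalInput W Set.univ q) {j : ℕ}
    (hA : familyA κ (j + 1) = ∅) :
    maxOver κ (familyB κ (j + 1)) = ((mutualInfo W q : ℝ) : EReal) := by
  obtain ⟨Z, hZ, hsub⟩ := exists_mem_familyB hW hli hN hq hA
  refine le_antisymm (maxOver_familyB_le hW hli hq _) ?_
  exact (EReal.coe_le_coe_iff.mpr (mutualInfo_le_cHat hW hli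
    (mem_inputsOn_of_support_subset hq.1.1 hsub))).trans
      (le_iSup₂ (f := fun Z (_ : Z ∈ familyB κ (j + 1)) => ((cHat κ Zᶜ : ℝ) : EReal)) Z hZ)

theorem exists_stopsAt (κ : CoordinateChoice W) : ∃ j, StopsAt κ j := by
  classical
  have hex : ∃ j, 2 ≤ j ∧ familyA κ j = ∅ :=
    ⟨Fintype.card X + 1 + 1, by omega, familyA_eq_empty_of_card_lt (by omega)⟩
  refine ⟨Nat.find hex, (Nat.find_spec hex).1, (Nat.find_spec hex).2, fun i hi hlt => ?_⟩
  rw [Set.nonempty_iff_ne_empty]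
  exact fun he => Nat.find_min hex hlt ⟨hi, he⟩

theorem support_eq_of_isMax (hW : IsChannel W) (hli : LinearIndependent ℝ W)
    (hN : (negSet κ Set.univ).Nonempty) (hq : IsOptimalInput W Set.univ q) {j : ℕ}
    (hA : familyA κ (j + 1) = ∅) {Z : Set X} (hZ : Z ∈ familyB κ (j + 1))
    (hmax : ∀ Z' ∈ familyB κ (j + 1), cHat κ Z'ᶜ ≤ cHat κ Zᶜ) :
    Function.support q = {x | x ∈ Zᶜ ∧ 0 < unconstrained κ Zᶜ x} ∧
      ((∀ x ∈ Zᶜ, unconstrained κ Zᶜ x ≠ 0) → Function.support q = Zᶜ) := by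
  obtain ⟨Z', hZ', hsub⟩ := exists_mem_familyB hW hli hN hq hA
  have hle := (mutualInfo_le_cHat (κ := κ) hW hli
    (mem_inputsOn_of_support_subset hq.1.1 hsub)).trans (hmax Z' hZ')
  have hNZ := negSet_compl_eq_empty_of_mem_familyB hZ
  have hpos := mutualInfo_pos hW hli hN hq
  have heq := eq_unconstrained hW hli hq hpos hNZ hle
  -- For empty `Zᶜ` the unconstrained solution is zero by definition.
  have hzero : ∀ x, x ∉ Zᶜ → q x = 0 := by
    intro x hx
    by_cases hne : (Zᶜ).Nonempty
    · rw [heq, (isEqualizer_unconstrained hW hli hne).eq_zero x hx]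
    · rw [heq, unconstrained, dif_neg hne, Pi.zero_apply]
  rw [← heq]
  refine ⟨?_, fun h => ?_⟩
  · ext x
    refine ⟨fun hx => ⟨not_not.mp fun h => hx (hzero x h), (hq.1.1.1 x).lt_of_ne' hx⟩,
      fun hx => hx.2.ne'⟩
  · ext x
    exact ⟨fun hx => not_not.mp fun h => hx (hzero x h), fun hx => h x hx⟩

theorem outputs_iff [Nonempty X] (hW : IsChannel W) (hli : LinearIndependent ℝ W)
    (κ : CoordinateChoice W) (c : EReal) :
    Outputs κ c ↔ c = ((capacity W Set.univ : ℝ) : EReal) := by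
  obtain ⟨q, hq⟩ := exists_isOptimalInput (S := Set.univ) hW Set.univ_nonempty
  -- Every stopping index yields the same output, so uniqueness of the index is not needed.
  have hmax : (negSet κ Set.univ).Nonempty → ∀ j, StopsAt κ j →
      maxOver κ (familyB κ j) = ((capacity W Set.univ : ℝ) : EReal) := by
    rintro hN j ⟨hj, hA, -⟩
    obtain ⟨i, rfl⟩ : ∃ i, j = i + 1 := ⟨j - 1, by omega⟩
    rw [maxOver_familyB_eq hW hli hN hq hA, hq.capacity_eq]
  constructor
  · rintro (⟨hN, rfl⟩ | ⟨hN, j, hj, rfl⟩)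
    · rw [cHat_eq_capacity hW hli Set.univ_nonempty hN]
    · exact hmax hN j hj
  · rintro rfl
    rcases (negSet κ Set.univ).eq_empty_or_nonempty with hN | hN
    · exact Or.inl ⟨hN, by rw [cHat_eq_capacity hW hli Set.univ_nonempty hN]⟩
    · obtain ⟨j, hj⟩ := exists_stopsAt κ
      exact Or.inr ⟨hN, j, hj, (hmax hN j hj).symm⟩

end Rounds

end ChannelCapacity

theorem mainTheorem12 {X Y : Type*} [Fintype X] [Nonempty X] [Fintype Y]
    (W : X → Y → ℝ) (hW : ChannelCapacity.IsChannel W) (hli : LinearIndependent ℝ W) :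
    -- All objects are well defined, for every nonempty set `S` of inputs.
    (∀ S : Set X, S.Nonempty →
      (∃! q, ChannelCapacity.IsOptimalInput W S q) ∧
      Nonempty (ChannelCapacity.OutputCoordinates W S) ∧
      ∀ c : ChannelCapacity.OutputCoordinates W S,
        (∃! θ, c.IsMinimizer θ) ∧ (∃! v, c.IsSolution v)) ∧
    -- The remaining claims hold for every choice of coordinates.
    ∀ κ : ChannelCapacity.CoordinateChoice W,
      (∀ S : Set X, S.Nonempty → ChannelCapacity.negSet κ S = ∅ →
        ChannelCapacity.cHat κ S = ChannelCapacity.capacity W S) ∧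
      (∀ S : Set X, (ChannelCapacity.negSet κ S).Nonempty →
        ∀ q, ChannelCapacity.IsOptimalInput W S q →
          ((S \ Function.support q) ∩ ChannelCapacity.negSet κ S).Nonempty) ∧
      ((ChannelCapacity.negSet κ Set.univ).Nonempty →
        ∀ q, ChannelCapacity.IsOptimalInput W Set.univ q → ∀ j : ℕ, 1 ≤ j →
          (∃ X₁ ∈ ChannelCapacity.familyA κ j ∪ ChannelCapacity.familyB κ j,
            Function.support q ⊆ X₁ᶜ) ∧
          (ChannelCapacity.familyA κ j = ∅ →
            (∃ X₁ ∈ ChannelCapacity.familyB κ j, Function.support q ⊆ X₁ᶜ) ∧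
            ∀ X₁ ∈ ChannelCapacity.familyB κ j,
              (∀ X₂ ∈ ChannelCapacity.familyB κ j,
                ChannelCapacity.cHat κ X₂ᶜ ≤ ChannelCapacity.cHat κ X₁ᶜ) →
              Function.support q = {x | x ∈ X₁ᶜ ∧ 0 < ChannelCapacity.unconstrained κ X₁ᶜ x} ∧
              ((∀ x ∈ X₁ᶜ, ChannelCapacity.unconstrained κ X₁ᶜ x ≠ 0) →
                Function.support q = X₁ᶜ))) ∧
      -- The algorithm stops, and its output is the capacity.
      (∀ c : EReal, ChannelCapacity.Outputs κ c ↔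
        c = ((ChannelCapacity.capacity W Set.univ : ℝ) : EReal)) := by
  refine ⟨fun S hS => ⟨?_, ChannelCapacity.nonempty_outputCoordinates hW hS, fun c =>
    ⟨c.existsUnique_isMinimizer hW hli, c.existsUnique_isSolution hW hli⟩⟩, fun κ =>
    ⟨fun S hS hN => ChannelCapacity.cHat_eq_capacity hW hli hS hN, fun S hN q hq =>
      ChannelCapacity.exists_mem_negSet_notMem_support hW hli hN hq, ?_,
      ChannelCapacity.outputs_iff hW hli κ⟩⟩
  · obtain ⟨q, hq⟩ := ChannelCapacity.exists_isOptimalInput hW hS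
    exact ⟨q, hq, fun q' hq' => ChannelCapacity.isOptimalInput_unique hW hli hq' hq⟩
  · intro hN q hq j hj
    obtain ⟨i, rfl⟩ : ∃ i, j = i + 1 := ⟨j - 1, by omega⟩
    refine ⟨?_, fun hA => ⟨ChannelCapacity.exists_mem_familyB hW hli hN hq hA, fun Z hZ hmax =>
      ChannelCapacity.support_eq_of_isMax hW hli hN hq hA hZ hmax⟩⟩
    rcases ChannelCapacity.exists_mem_familyB_or_familyA hW hli hN hq i with
      ⟨Z, hZ, hsub⟩ | ⟨Z, hZ, hsub, -⟩
    · exact ⟨Z, Or.inr hZ, hsub⟩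
    · exact ⟨Z, Or.inl hZ, hsub⟩
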